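/- Let $n\ge 1$, $V=n^2$, and let $\mathcal G=(\mathcal V,\mathcal E)$ be the $\sqrt V\times\sqrt V$ grid graph, with vertex set $\{1,\dots,n\}^2$ and two vertices adjacent when they agree in one coordinate and differ by $1$ in the other. For a weight function $w:\mathcal E\to[0,\infty)$ let $d_w(x,y)$ be the minimum, over paths from $x$ to $y$, of the sum of the weights of the edges of the path. A randomized algorithm $\mathcal A$ whose input is a weight function is $(\epsilon,\delta)$-differentially private if $\Pr[\mathcal A(w)\in S]\le e^{\epsilon}\Pr[\mathcal A(w')\in S]+\delta$ for every measurable set $S$ of outputs and all $w,w':\mathcal E\to[0,\infty)$ with $\sum_{e\in\mathcal E}|w(e)-w'(e)|\le 1$. **Theorem.** For every $\delta_0<1$ there is a constant $C>0$, depending only on $\delta_0$, such that for all $n\ge1$, with $V=n^2$, all $\epsilon,\gamma\in(0,1)$ and all $0<\delta\le\delta_0$ there is an $(\epsilon,\delta)$-differentially private algorithm $\mathcal A$ on the $\sqrt V\times\sqrt V$ grid, which outputs a real number $a(x,y)$ for each pair of vertices $x,y$, such that for every $\Lambda\ge0$ and every $w:\mathcal E\to[0,\Lambda]$, with probability at least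 $1-\gamma$ the output of $\mathcal A(w)$ satisfies $$|a(x,y)-d_w(x,y)|\le V^{1/3}\cdot C\left(\Lambda+\epsilon^{-1}\log(V/\gamma)\sqrt{\log(1/\delta)}\right)\quad\text{for all } x,y\in\mathcal V \text{ simultaneously.}$$ -/

import Mathlib

open MeasureTheory
open scoped NNReal

namespace PrivateDistances

/-- A weight function `w : E → ℝ⁺`: a nonnegative real number on each edge of `G`. -/
abbrev WeightFunction {V : Type*} (G : SimpleGraph V) : Type _ := G.edgeSet → ℝ≥0

/-- The weight of a walk: the sum of the weights of its edges. -/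
def walkWeight {V : Type*} {G : SimpleGraph V} (w : WeightFunction G) :
    {x y : V} → G.Walk x y → ℝ
  | _, _, .nil => 0
  | _, _, .cons h p => (w ⟨s(_, _), h⟩ : ℝ) + walkWeight w p

/-- The weighted distance `d_w(x, y)`, the least weight of a path from `x` to `y`
(used for connected graphs, so that there is a path). -/
noncomputable def weightedDist {V : Type*} {G : SimpleGraph V} (w : WeightFunction G)
    (x y : V) : ℝ :=
  ⨅ p : G.Path x y, walkWeight w p.1

open Classical in
/-- On a finite connected graph the infimum in `weightedDist` is a minimum. -/
theorem isLeast_weightedDist {V : Type*} [Finite V] {G : SimpleGraph V} (hG : G.Connected)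
    (w : WeightFunction G) (x y : V) :
    IsLeast (Set.range fun p : G.Path x y => walkWeight w p.1) (weightedDist w x y) := by
  have := Fintype.ofFinite V
  have : Nonempty (G.Path x y) := by
    obtain ⟨p⟩ := hG.preconnected x y
    exact ⟨p.toPath⟩
  have hfin : (Set.range fun p : G.Path x y => walkWeight w p.1).Finite := Set.finite_range _
  exact ⟨(Set.range_nonempty _).csInf_mem hfin, fun a ha => csInf_le hfin.bddBelow ha⟩

open Classical in
/-- Two weight functions are neighboring if their `ℓ¹` distance is at most one. -/
def Neighboring {V : Type*} [Fintype V] {G : SimpleGraph V} (w w' : WeightFunction G) : Prop :=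
  ∑ e : G.edgeSet, |(w e : ℝ) - (w' e : ℝ)| ≤ 1

/-- A randomized algorithm with inputs in the weight functions of `G` and outputs in `Ω`, given by
the law of its output on each input. -/
abbrev Mechanism {V : Type*} (G : SimpleGraph V) (Ω : Type*) [MeasurableSpace Ω] : Type _ :=
  WeightFunction G → ProbabilityMeasure Ω

/-- `(ε, δ)`-differential privacy of a randomized algorithm on `G`. -/
def IsDifferentiallyPrivate {V : Type*} [Fintype V] {G : SimpleGraph V} {Ω : Type*}
    [MeasurableSpace Ω] (A : Mechanism G Ω) (ε δ : ℝ) : Prop :=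
  ∀ w w' : WeightFunction G, Neighboring w w' → ∀ S : Set Ω, MeasurableSet S →
    (A w : Measure Ω).real S ≤ Real.exp ε * (A w' : Measure Ω).real S + δ

/-- The `n × n` grid: `(i, j)` and `(i', j')` are adjacent when they agree in one coordinate and
differ by one in the other. -/
abbrev grid (n : ℕ) : SimpleGraph (Fin n × Fin n) :=
  (SimpleGraph.pathGraph n).boxProd (SimpleGraph.pathGraph n)

/-- The event that the released values `a` approximate all the distances `d_w(x, y)` with
error at most `B`. -/
def accurate {V : Type*} {G : SimpleGraph V} (w : WeightFunction G) (B : ℝ) :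
    Set (V → V → ℝ) :=
  {a | ∀ x y : V, |a x y - weightedDist w x y| ≤ B}

end PrivateDistances

/-! Put R = V^(1/3). Centres spaced about R apart in both coordinates number O(R), and every vertex
is within weight O(RΛ) of one of them, so replacing both endpoints of a pair by their centres costs
O(RΛ). Only the O(R²) distances between centres need to be released. Each has sensitivity one
(`Neighboring.abs_weightedDist_sub_le`), so together they have ℓ² sensitivity O(R), and Gaussian
noise with standard deviation about R√(log(1/δ))/ε makes them private (`gaussianPi_real_le`). A
union bound over the pairs of centres (`gaussianPi_real_exists_abs_sub_le`) adds the factor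
log(V/γ). The spacing R balances the two errors. -/

namespace PrivateDistances

/-! ### Weighted distances: metric properties and sensitivity. -/

section Graph

variable {V : Type*} {G : SimpleGraph V}

theorem walkWeight_eq_sum_darts (w : WeightFunction G) {x y : V} (p : G.Walk x y) :
    walkWeight w p = (p.darts.map fun d => (w ⟨d.edge, d.edge_mem⟩ : ℝ)).sum := by
  induction p with
  | nil => simp [walkWeight]
  | cons h p ih => simp [walkWeight, ih, SimpleGraph.Dart.edge]

theorem walkWeight_nonneg (w : WeightFunction G) {x y : V} (p : G.Walk x y) :
    0 ≤ walkWeight w p := by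
  induction p with
  | nil => simp [walkWeight]
  | cons h p ih => simp only [walkWeight]; positivity

theorem walkWeight_append (w : WeightFunction G) {x y z : V} (p : G.Walk x y) (q : G.Walk y z) :
    walkWeight w (p.append q) = walkWeight w p + walkWeight w q := by
  simp [walkWeight_eq_sum_darts]

theorem walkWeight_reverse (w : WeightFunction G) {x y : V} (p : G.Walk x y) :
    walkWeight w p.reverse = walkWeight w p := by
  induction p with
  | nil => rfl
  | cons h p ih =>
    simp only [SimpleGraph.Walk.reverse_cons, walkWeight_append, ih, walkWeight, add_zero]
    rw [add_comm]
    congr 4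
    exact Sym2.eq_swap

open Classical in
theorem walkWeight_toPath_le (w : WeightFunction G) {x y : V} (p : G.Walk x y) :
    walkWeight w p.toPath.1 ≤ walkWeight w p := by
  rw [walkWeight_eq_sum_darts, walkWeight_eq_sum_darts]
  refine List.Sublist.sum_le_sum (p.darts_bypass_sublist_darts.map _) fun a ha => ?_
  obtain ⟨d, -, rfl⟩ := List.mem_map.1 ha
  exact NNReal.coe_nonneg _

theorem weightedDist_nonneg (w : WeightFunction G) (x y : V) : 0 ≤ weightedDist w x y :=
  Real.iInf_nonneg fun p => walkWeight_nonneg w p.1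

open Classical in
theorem weightedDist_le_walkWeight (w : WeightFunction G) {x y : V} (p : G.Walk x y) :
    weightedDist w x y ≤ walkWeight w p := by
  refine le_trans (ciInf_le ⟨0, ?_⟩ p.toPath) (walkWeight_toPath_le w p)
  rintro _ ⟨q, rfl⟩
  exact walkWeight_nonneg w q.1

theorem weightedDist_self (w : WeightFunction G) (x : V) : weightedDist w x x = 0 :=
  le_antisymm (weightedDist_le_walkWeight w .nil) (weightedDist_nonneg w x x)

theorem weightedDist_le_of_adj (w : WeightFunction G) {x y : V} (h : G.Adj x y) :
    weightedDist w x y ≤ w ⟨s(x, y), h⟩ :=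
  (weightedDist_le_walkWeight w (.cons h .nil)).trans (by simp [walkWeight])

theorem weightedDist_triangle [Finite V] (hG : G.Connected) (w : WeightFunction G) (x y z : V) :
    weightedDist w x z ≤ weightedDist w x y + weightedDist w y z := by
  obtain ⟨p, hp⟩ := (isLeast_weightedDist hG w x y).1
  obtain ⟨q, hq⟩ := (isLeast_weightedDist hG w y z).1
  simp only at hp hq
  rw [← hp, ← hq, ← walkWeight_append]
  exact weightedDist_le_walkWeight w _

theorem weightedDist_comm [Finite V] (hG : G.Connected) (w : WeightFunction G) (x y : V) :
    weightedDist w x y = weightedDist w y x := by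
  have key : ∀ x y : V, weightedDist w x y ≤ weightedDist w y x := fun x y => by
    obtain ⟨p, hp⟩ := (isLeast_weightedDist hG w y x).1
    simp only at hp
    rw [← hp, ← walkWeight_reverse]
    exact weightedDist_le_walkWeight w _
  exact le_antisymm (key x y) (key y x)

/-- The distances between nearby vertices may replace the given ones. -/
theorem abs_weightedDist_sub_le [Finite V] (hG : G.Connected) (w : WeightFunction G)
    {x x' y y' : V} {r : ℝ} (hx : weightedDist w x x' ≤ r) (hy : weightedDist w y y' ≤ r) :
    |weightedDist w x' y' - weightedDist w x y| ≤ 2 * r := by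
  have h1 := weightedDist_triangle hG w x x' y
  have h2 := weightedDist_triangle hG w x' y' y
  have h3 := weightedDist_triangle hG w x' x y'
  have h4 := weightedDist_triangle hG w x y y'
  rw [weightedDist_comm hG w y' y] at h2
  rw [weightedDist_comm hG w x' x] at h3
  rw [abs_le]
  constructor <;> linarith

open Classical in
-- A path uses each edge at most once, so its weight changes by at most the ℓ¹ distance. For walks
-- with repeated edges this fails.
theorem walkWeight_le_add_sum [Fintype V] (w w' : WeightFunction G) {x y : V} (p : G.Path x y) :
    walkWeight w p.1 ≤ walkWeight w' p.1 + ∑ e : G.edgeSet, |(w e : ℝ) - (w' e : ℝ)| := by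
  -- Extending by zero to all of `Sym2 V` allows summing over the list of edges of a walk.
  let f : Sym2 V → ℝ := fun e =>
    if h : e ∈ G.edgeSet then |(w ⟨e, h⟩ : ℝ) - (w' ⟨e, h⟩ : ℝ)| else 0
  have hf : ∀ e, 0 ≤ f e := fun e => by
    by_cases h : e ∈ G.edgeSet <;> simp [f, h]
  have key : ∀ {x y : V} (p : G.Walk x y),
      walkWeight w p ≤ walkWeight w' p + (p.edges.map f).sum := by
    intro x y p
    induction p with
    | nil => simp [walkWeight]
    | @cons u v _ h p ih =>
      have : f s(u, v) = |(w ⟨s(u, v), h⟩ : ℝ) - (w' ⟨s(u, v), h⟩ : ℝ)| :=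
        dif_pos (show s(u, v) ∈ G.edgeSet from h)
      have h2 := le_abs_self ((w ⟨s(u, v), h⟩ : ℝ) - (w' ⟨s(u, v), h⟩ : ℝ))
      simp only [walkWeight, SimpleGraph.Walk.edges_cons, List.map_cons, List.sum_cons, this]
      linarith
  refine (key p.1).trans (add_le_add le_rfl ?_)
  have hsum : ∑ e : G.edgeSet, |(w e : ℝ) - (w' e : ℝ)|
      = ∑ e ∈ Finset.univ.map (Function.Embedding.subtype (· ∈ G.edgeSet)), f e := by
    rw [Finset.sum_map]
    refine Finset.sum_congr rfl fun e _ => ?_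
    have he : (e : Sym2 V) ∈ G.edgeSet := e.2
    simp [f, he]
  rw [hsum, ← List.sum_toFinset f p.2.isTrail.edges_nodup]
  refine Finset.sum_le_sum_of_subset_of_nonneg (fun e he => ?_) fun e _ _ => hf e
  simpa using SimpleGraph.Walk.edges_subset_edgeSet p.1 (List.mem_toFinset.1 he)

theorem Neighboring.symm [Fintype V] {w w' : WeightFunction G} (h : Neighboring w w') :
    Neighboring w' w := by
  simpa only [Neighboring, abs_sub_comm] using h

/-- Distances have sensitivity one. -/
theorem Neighboring.abs_weightedDist_sub_le [Fintype V] (hG : G.Connected) {w w' : WeightFunction G}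
    (h : Neighboring w w') (x y : V) : |weightedDist w x y - weightedDist w' x y| ≤ 1 := by
  have key : ∀ {w w' : WeightFunction G}, Neighboring w w' →
      weightedDist w x y ≤ weightedDist w' x y + 1 := fun {w w'} h => by
    obtain ⟨p, hp⟩ := (isLeast_weightedDist hG w' x y).1
    simp only at hp
    rw [← hp]
    exact (weightedDist_le_walkWeight w p.1).trans
      ((walkWeight_le_add_sum w w' p).trans (add_le_add le_rfl h))
  have h1 := key h
  have h2 := key h.symm
  rw [abs_le]
  constructor <;> linarith

end Graph

/-! ### Distances in a grid with bounded weights. -/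

section Grid

theorem grid_connected {n : ℕ} (hn : 1 ≤ n) : (grid n).Connected := by
  obtain ⟨k, rfl⟩ := Nat.exists_eq_add_of_le' hn
  exact (SimpleGraph.pathGraph_connected k).boxProd (SimpleGraph.pathGraph_connected k)

theorem weightedDist_grid_left_le {n : ℕ} (w : WeightFunction (grid n)) {Λ : ℝ}
    (hw : ∀ e, (w e : ℝ) ≤ Λ) (j : Fin n) (k : ℕ) (i i' : Fin n) (h : (i' : ℕ) = i + k) :
    weightedDist w (i, j) (i', j) ≤ k * Λ := by
  have hG : (grid n).Connected := grid_connected (Nat.one_le_of_lt j.2)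
  induction k generalizing i' with
  | zero =>
    obtain rfl : i' = i := Fin.ext h
    simp [weightedDist_self]
  | succ k ih =>
    let l : Fin n := ⟨i + k, by omega⟩
    have hadj : (grid n).Adj (l, j) (i', j) := by
      rw [SimpleGraph.boxProd_adj, SimpleGraph.pathGraph_adj, SimpleGraph.pathGraph_adj]
      exact Or.inl ⟨Or.inl (by simp only [l]; omega), rfl⟩
    have h1 := ih l rfl
    have h2 := (weightedDist_le_of_adj w hadj).trans (hw _)
    have h3 := weightedDist_triangle hG w (i, j) (l, j) (i', j)
    push_cast
    linarith

theorem weightedDist_grid_right_le {n : ℕ} (w : WeightFunction (grid n)) {Λ : ℝ}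
    (hw : ∀ e, (w e : ℝ) ≤ Λ) (i : Fin n) (k : ℕ) (j j' : Fin n) (h : (j' : ℕ) = j + k) :
    weightedDist w (i, j) (i, j') ≤ k * Λ := by
  have hG : (grid n).Connected := grid_connected (Nat.one_le_of_lt j.2)
  induction k generalizing j' with
  | zero =>
    obtain rfl : j' = j := Fin.ext h
    simp [weightedDist_self]
  | succ k ih =>
    let l : Fin n := ⟨j + k, by omega⟩
    have hadj : (grid n).Adj (i, l) (i, j') := by
      rw [SimpleGraph.boxProd_adj, SimpleGraph.pathGraph_adj, SimpleGraph.pathGraph_adj]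
      exact Or.inr ⟨Or.inl (by simp only [l]; omega), rfl⟩
    have h1 := ih l rfl
    have h2 := (weightedDist_le_of_adj w hadj).trans (hw _)
    have h3 := weightedDist_triangle hG w (i, j) (i, l) (i, j')
    push_cast
    linarith

theorem weightedDist_grid_le {n : ℕ} (w : WeightFunction (grid n)) {Λ : ℝ} (hΛ : 0 ≤ Λ)
    (hw : ∀ e, (w e : ℝ) ≤ Λ) {s : ℕ} {x y : Fin n × Fin n}
    (h₁ : (y.1 : ℕ) ≤ x.1) (h₁' : (x.1 : ℕ) ≤ y.1 + s)
    (h₂ : (y.2 : ℕ) ≤ x.2) (h₂' : (x.2 : ℕ) ≤ y.2 + s) :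
    weightedDist w x y ≤ 2 * s * Λ := by
  have hG : (grid n).Connected := grid_connected (Nat.one_le_of_lt x.1.2)
  obtain ⟨i, j⟩ := x
  obtain ⟨i', j'⟩ := y
  simp only at h₁ h₁' h₂ h₂'
  have a := weightedDist_grid_left_le w hw j' (i - i') i' i (by omega)
  have b := weightedDist_grid_right_le w hw i (j - j') j' j (by omega)
  have c := weightedDist_triangle hG w (i', j') (i, j') (i, j)
  have a' : ((i - i' : ℕ) : ℝ) * Λ ≤ s * Λ :=
    mul_le_mul_of_nonneg_right (by exact_mod_cast (by omega : (i : ℕ) - i' ≤ s)) hΛ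
  have b' : ((j - j' : ℕ) : ℝ) * Λ ≤ s * Λ :=
    mul_le_mul_of_nonneg_right (by exact_mod_cast (by omega : (j : ℕ) - j' ≤ s)) hΛ
  rw [weightedDist_comm hG]
  linarith

end Grid

/-! ### Gaussian noise: privacy loss and tails. -/

section Gaussian

open ProbabilityTheory
open scoped ENNReal

variable {ι : Type*} [Fintype ι]

/-- It suffices to check boxes, where independence of the coordinates factors the integral of the
product density. -/
theorem pi_eq_withDensity_prod {α : ι → Type*} [∀ i, MeasurableSpace (α i)]
    (μ ν : ∀ i, Measure (α i)) [∀ i, IsProbabilityMeasure (μ i)] [∀ i, IsProbabilityMeasure (ν i)]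
    (f : ∀ i, α i → ℝ≥0∞) (hf : ∀ i, Measurable (f i)) (h : ∀ i, μ i = (ν i).withDensity (f i)) :
    Measure.pi μ = (Measure.pi ν).withDensity fun x => ∏ i, f i (x i) := by
  refine Measure.pi_eq fun s hs => ?_
  have hind : iIndepFun (fun i (x : ∀ i, α i) => (s i).indicator (f i) (x i)) (Measure.pi ν) :=
    iIndepFun_pi fun i => ((hf i).indicator (hs i)).aemeasurable
  have hprod : ∀ x : ∀ i, α i, (Set.univ.pi s).indicator (fun x => ∏ i, f i (x i)) x
      = ∏ i, (s i).indicator (f i) (x i) := fun x => by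
    classical
    by_cases hx : x ∈ Set.univ.pi s
    · rw [Set.indicator_of_mem hx]
      exact Finset.prod_congr rfl fun i _ => (Set.indicator_of_mem (hx i trivial) _).symm
    · rw [Set.indicator_of_notMem hx]
      simp only [Set.mem_pi, Set.mem_univ, true_imp_iff, not_forall] at hx
      obtain ⟨i, hi⟩ := hx
      exact (Finset.prod_eq_zero (Finset.mem_univ i) (Set.indicator_of_notMem hi _)).symm
  rw [withDensity_apply _ (MeasurableSet.univ_pi hs), ← lintegral_indicator (.univ_pi hs)]
  simp_rw [hprod]
  rw [lintegral_prod_eq_prod_lintegral_of_indepFun Finset.univ _ hind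
    fun i => ((hf i).indicator (hs i)).comp (measurable_pi_apply i)]
  refine Finset.prod_congr rfl fun i _ => ?_
  rw [h i, withDensity_apply _ (hs i), ← lintegral_indicator (hs i)]
  exact ((measurePreserving_eval ν i).lintegral_comp ((hf i).indicator (hs i)))

/-- If the privacy loss exceeds `ε` with probability at most `δ`, the two laws are
`(ε, δ)`-indistinguishable. -/
theorem real_le_exp_mul_add {Ω : Type*} [MeasurableSpace Ω] {P Q : Measure Ω}
    [IsProbabilityMeasure P] [IsProbabilityMeasure Q] {L : Ω → ℝ} (hL : Measurable L)
    (hPQ : P = Q.withDensity fun x => ENNReal.ofReal (Real.exp (L x))) {ε δ : ℝ}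
    (hδ : P.real {x | ε ≤ L x} ≤ δ) {S : Set Ω} (hS : MeasurableSet S) :
    P.real S ≤ Real.exp ε * Q.real S + δ := by
  have hT : MeasurableSet {x | ε ≤ L x} := measurableSet_le measurable_const hL
  have h1 : P.real S ≤ P.real (S \ {x | ε ≤ L x}) + P.real {x | ε ≤ L x} :=
    (measureReal_mono (by intro x hx; by_cases h : ε ≤ L x <;> simp [hx, h])).trans
      (measureReal_union_le _ _)
  have h2 : P (S \ {x | ε ≤ L x}) ≤ ENNReal.ofReal (Real.exp ε) * Q S := by
    rw [hPQ, withDensity_apply _ (hS.diff hT)]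
    calc ∫⁻ x in S \ {x | ε ≤ L x}, ENNReal.ofReal (Real.exp (L x)) ∂Q
        ≤ ∫⁻ _ in S \ {x | ε ≤ L x}, ENNReal.ofReal (Real.exp ε) ∂Q := by
          refine setLIntegral_mono measurable_const fun x hx => ?_
          exact ENNReal.ofReal_le_ofReal (Real.exp_le_exp.2 (not_le.1 hx.2).le)
      _ = ENNReal.ofReal (Real.exp ε) * Q (S \ {x | ε ≤ L x}) := by simp
      _ ≤ _ := by gcongr; exact Set.sdiff_subset
  have h3 : P.real (S \ {x | ε ≤ L x}) ≤ Real.exp ε * Q.real S := by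
    have := ENNReal.toReal_mono (ENNReal.mul_ne_top ENNReal.ofReal_ne_top (measure_ne_top _ _)) h2
    rwa [ENNReal.toReal_mul, ENNReal.toReal_ofReal (Real.exp_pos _).le] at this
  linarith

theorem gaussianReal_eq_withDensity (a b : ℝ) {v : ℝ≥0} (hv : v ≠ 0) :
    gaussianReal a v = (gaussianReal b v).withDensity fun x =>
      ENNReal.ofReal (Real.exp (((x - b) ^ 2 - (x - a) ^ 2) / (2 * v))) := by
  rw [gaussianReal_of_var_ne_zero _ hv, gaussianReal_of_var_ne_zero _ hv,
    ← withDensity_mul _ (measurable_gaussianPDF _ _) (by fun_prop)]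
  congr 1
  ext x
  simp only [Pi.mul_apply, gaussianPDF, gaussianPDFReal]
  rw [← ENNReal.ofReal_mul (by positivity), mul_assoc (√_)⁻¹, ← Real.exp_add]
  congr 3
  ring

theorem hasSubgaussianMGF_sub_gaussianReal (a : ℝ) (v : ℝ≥0) :
    HasSubgaussianMGF (fun x => x - a) v (gaussianReal a v) := by
  have h : (gaussianReal a v).map (fun x => x - a) = gaussianReal 0 v := by
    rw [gaussianReal_map_sub_const, sub_self]
  have hid : HasSubgaussianMGF id v (gaussianReal 0 v) :=
    ⟨fun t => integrable_exp_mul_gaussianReal t, fun t => by simp [mgf_id_gaussianReal]⟩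
  rw [← h] at hid
  exact hid.of_map (by fun_prop)

/-- The product of the Gaussian laws with the given means and a common variance. -/
noncomputable abbrev gaussianPi (a : ι → ℝ) (v : ℝ≥0) : Measure (ι → ℝ) :=
  Measure.pi fun i => gaussianReal (a i) v

theorem hasSubgaussianMGF_eval_sub_gaussianPi (a : ι → ℝ) (v : ℝ≥0) (i : ι) :
    HasSubgaussianMGF (fun x : ι → ℝ => x i - a i) v (gaussianPi a v) := by
  have h := hasSubgaussianMGF_sub_gaussianReal (a i) v
  rw [← (measurePreserving_eval (fun i => gaussianReal (a i) v) i).map_eq] at h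
  exact h.of_map (μ := gaussianPi a v) (Y := Function.eval i) (measurable_pi_apply i).aemeasurable

theorem hasSubgaussianMGF_mono {Ω : Type*} [MeasurableSpace Ω] {μ : Measure Ω} {X : Ω → ℝ}
    {c d : ℝ≥0} (h : HasSubgaussianMGF X c μ) (hcd : c ≤ d) : HasSubgaussianMGF X d μ :=
  ⟨h.integrable_exp_mul, fun t => (h.mgf_le t).trans (Real.exp_le_exp.2 (by gcongr))⟩

theorem hasSubgaussianMGF_sum_mul_gaussianPi (a d : ι → ℝ) (v : ℝ≥0) (hd : ∀ i, |d i| ≤ 1) :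
    HasSubgaussianMGF (fun x : ι → ℝ => ∑ i, d i * (x i - a i)) (Fintype.card ι * v)
      (gaussianPi a v) := by
  have hind : iIndepFun (fun i (x : ι → ℝ) => d i * (x i - a i)) (gaussianPi a v) :=
    iIndepFun_pi (X := fun i t => d i * (t - a i)) fun i => by fun_prop
  have := HasSubgaussianMGF.sum_of_iIndepFun hind (c := fun _ => v) (s := Finset.univ)
    fun i _ => hasSubgaussianMGF_mono
      ((hasSubgaussianMGF_eval_sub_gaussianPi a v i).const_mul (d i)) <| by
        refine mul_le_of_le_one_left (zero_le) ?_
        exact (sq_le_one_iff_abs_le_one _).2 (hd i)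
  simpa using this

/-- The Gaussian mechanism for `Fintype.card ι` queries of sensitivity one. -/
theorem gaussianPi_real_le {a b : ι → ℝ} (hab : ∀ i, |a i - b i| ≤ 1) {v : ℝ≥0} {ε δ : ℝ}
    (hv : v ≠ 0) (hε : 0 ≤ ε) (h₁ : (Fintype.card ι : ℝ) ≤ v * ε)
    (h₂ : Real.exp (-(v * ε ^ 2 / (8 * Fintype.card ι))) ≤ δ) {S : Set (ι → ℝ)}
    (hS : MeasurableSet S) :
    (gaussianPi a v).real S ≤ Real.exp ε * (gaussianPi b v).real S + δ := by
  have hv' : (0 : ℝ) < v := by positivity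
  refine real_le_exp_mul_add
    (L := fun x => ∑ i, ((x i - b i) ^ 2 - (x i - a i) ^ 2) / (2 * v)) (by fun_prop) ?_ ?_ hS
  · rw [gaussianPi, pi_eq_withDensity_prod _ _ _ (fun i => by fun_prop)
      fun i => gaussianReal_eq_withDensity (a i) (b i) hv]
    congr 1
    ext x
    rw [Real.exp_sum, ENNReal.ofReal_prod_of_nonneg fun i _ => (Real.exp_pos _).le]
  · refine le_trans ?_ h₂
    -- The squares of x cancel in the privacy loss, leaving (2⟨a-b, x-a⟩ + ‖a-b‖²)/(2v). As ‖a-b‖² ≤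
    -- K ≤ vε, with K the number of queries, a loss of at least ε forces ⟨a-b, x-a⟩ ≥ vε/2.
    have ht := (hasSubgaussianMGF_sum_mul_gaussianPi a (fun i => a i - b i) v hab).measure_ge_le
      (ε := v * ε / 2) (by positivity)
    refine le_trans (measureReal_mono fun x hx => ?_) (ht.trans_eq ?_)
    · change ε ≤ ∑ i, ((x i - b i) ^ 2 - (x i - a i) ^ 2) / (2 * v) at hx
      change v * ε / 2 ≤ ∑ i, (a i - b i) * (x i - a i)
      have hD : ∑ i, (a i - b i) ^ 2 ≤ Fintype.card ι := by
        refine (Finset.sum_le_sum fun i _ => (sq_le_one_iff_abs_le_one _).2 (hab i)).trans ?_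
        simp
      have hL : ∑ i, ((x i - b i) ^ 2 - (x i - a i) ^ 2) / (2 * v)
          = (2 * ∑ i, (a i - b i) * (x i - a i) + ∑ i, (a i - b i) ^ 2) / (2 * v) := by
        rw [Finset.mul_sum, ← Finset.sum_add_distrib, Finset.sum_div]
        exact Finset.sum_congr rfl fun i _ => by ring
      rw [hL, le_div_iff₀ (by positivity)] at hx
      linarith
    · congr 1
      push_cast
      -- With no queries both exponents are divisions by zero, hence 0.
      by_cases hK : (Fintype.card ι : ℝ) = 0
      · simp [hK]
      · field_simp
        norm_num

theorem gaussianPi_real_exists_abs_sub_le (a : ι → ℝ) (v : ℝ≥0) {t : ℝ} (ht : 0 ≤ t) :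
    (gaussianPi a v).real {x | ∃ i, t ≤ |x i - a i|}
      ≤ Fintype.card ι * (2 * Real.exp (-t ^ 2 / (2 * v))) := by
  have hi : ∀ i, (gaussianPi a v).real {x | t ≤ |x i - a i|} ≤ 2 * Real.exp (-t ^ 2 / (2 * v)) := by
    intro i
    have h := hasSubgaussianMGF_eval_sub_gaussianPi a v i
    have h1 := h.measure_ge_le ht
    have h2 := h.neg.measure_ge_le ht
    rw [two_mul]
    refine le_trans (measureReal_mono fun x hx => ?_)
      ((measureReal_union_le _ _).trans (add_le_add h1 h2))
    exact le_abs.1 (show t ≤ |x i - a i| from hx)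
  have hU : {x : ι → ℝ | ∃ i, t ≤ |x i - a i|} = ⋃ i, {x | t ≤ |x i - a i|} := by
    ext x; simp
  rw [hU]
  refine (measureReal_iUnion_fintype_le _).trans ((Finset.sum_le_sum fun i _ => hi i).trans ?_)
  simp

end Gaussian

/-! ### The mechanism on centres: privacy and accuracy. -/

section Release

theorem isDifferentiallyPrivate_const {V : Type*} [Fintype V] {G : SimpleGraph V} {Ω : Type*}
    [MeasurableSpace Ω] (P : ProbabilityMeasure Ω) {ε δ : ℝ} (hε : 0 ≤ ε) (hδ : 0 ≤ δ) :
    IsDifferentiallyPrivate (fun _ : WeightFunction G => P) ε δ := fun _ _ _ S _ => by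
  have := le_mul_of_one_le_left (measureReal_nonneg (μ := (P : Measure Ω)) (s := S))
    (Real.one_le_exp hε)
  linarith

theorem measurableSet_accurate {V : Type*} [Finite V] {G : SimpleGraph V} (w : WeightFunction G) (B : ℝ) :
    MeasurableSet (accurate w B) := by
  have : accurate w B = ⋂ x, ⋂ y, {a | |a x y - weightedDist w x y| ≤ B} := by
    ext a; simp [accurate]
  rw [this]
  refine .iInter fun x => .iInter fun y => measurableSet_le ?_ measurable_const
  have hxy : Measurable fun a : V → V → ℝ => a x y := by fun_prop
  exact (hxy.sub measurable_const).abs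

variable {V : Type*} {G : SimpleGraph V} {Z : Type*}

theorem measurable_pullback (c : V → Z) :
    Measurable fun (z : Z × Z → ℝ) (x y : V) => z (c x, c y) := by
  fun_prop

variable [Fintype Z]

/-- Release the distances between the centres `r z`, with Gaussian noise, and estimate the distance
of any two vertices by that of their centres. -/
noncomputable def centreMechanism (G : SimpleGraph V) (r : Z → V) (c : V → Z) (v : ℝ≥0) :
    Mechanism G (V → V → ℝ) := fun w =>
  ⟨(gaussianPi (fun q : Z × Z => weightedDist w (r q.1) (r q.2)) v).map
      fun z x y => z (c x, c y),
    Measure.isProbabilityMeasure_map (measurable_pullback c).aemeasurable⟩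

theorem centreMechanism_real_apply (r : Z → V) (c : V → Z) (v : ℝ≥0) (w : WeightFunction G)
    {S : Set (V → V → ℝ)} (hS : MeasurableSet S) :
    (centreMechanism G r c v w : Measure (V → V → ℝ)).real S =
      (gaussianPi (fun q : Z × Z => weightedDist w (r q.1) (r q.2)) v).real
        ((fun z x y => z (c x, c y)) ⁻¹' S) :=
  map_measureReal_apply (measurable_pullback c) hS

variable [Fintype V]

/-- Extending from centres to vertices is post-processing: an event pulls back to an event about the
noisy centre distances. -/
theorem isDifferentiallyPrivate_centreMechanism (hG : G.Connected) (r : Z → V) (c : V → Z)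
    {v : ℝ≥0} {ε δ : ℝ} (hv : v ≠ 0) (hε : 0 ≤ ε)
    (h₁ : (Fintype.card (Z × Z) : ℝ) ≤ v * ε)
    (h₂ : Real.exp (-(v * ε ^ 2 / (8 * Fintype.card (Z × Z)))) ≤ δ) :
    IsDifferentiallyPrivate (centreMechanism G r c v) ε δ := by
  intro w w' hw S hS
  rw [centreMechanism_real_apply r c v w hS, centreMechanism_real_apply r c v w' hS]
  exact gaussianPi_real_le (fun q => hw.abs_weightedDist_sub_le hG _ _) hv hε h₁ h₂
    (measurable_pullback c hS)

theorem le_centreMechanism_real_accurate (hG : G.Connected) {r : Z → V} {c : V → Z} (v : ℝ≥0)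
    {w : WeightFunction G} {ρ t γ B : ℝ} (hρ : ∀ x, weightedDist w x (r (c x)) ≤ ρ) (ht : 0 ≤ t)
    (hγ : Fintype.card (Z × Z) * (2 * Real.exp (-t ^ 2 / (2 * v))) ≤ γ) (hB : 2 * ρ + t ≤ B) :
    1 - γ ≤ (centreMechanism G r c v w : Measure (V → V → ℝ)).real (accurate w B) := by
  have hm := measurableSet_accurate w B
  rw [centreMechanism_real_apply r c v w hm]
  set P := gaussianPi (fun q : Z × Z => weightedDist w (r q.1) (r q.2)) v
  have hc := probReal_compl_eq_one_sub (μ := P) (measurable_pullback c hm)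
  have hbad := (gaussianPi_real_exists_abs_sub_le
    (fun q : Z × Z => weightedDist w (r q.1) (r q.2)) v ht).trans hγ
  have hsub : P.real ((fun z x y => z (c x, c y)) ⁻¹' accurate w B)ᶜ ≤ γ := by
    refine (measureReal_mono fun z hz => ?_).trans hbad
    by_contra hcon
    refine hz fun x y => ?_
    have h1 : |z (c x, c y) - weightedDist w (r (c x)) (r (c y))| < t :=
      not_le.1 fun h => hcon ⟨(c x, c y), h⟩
    have h2 := abs_weightedDist_sub_le hG w (hρ x) (hρ y)
    have h3 := abs_sub_le (z (c x, c y)) (weightedDist w (r (c x)) (r (c y))) (weightedDist w x y)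
    change |z (c x, c y) - weightedDist w x y| ≤ B
    linarith
  linarith

end Release

/-! ### Placing and counting the centres. -/

section GridCentres

/-- The interval `{0, …, n - 1}` has `(n - 1) / s + 1` centres such that every point lies at most
`s` above its centre. -/
theorem exists_centres {n s : ℕ} (hn : 1 ≤ n) (hs : 1 ≤ s) :
    ∃ (r : Fin ((n - 1) / s + 1) → Fin n) (c : Fin n → Fin ((n - 1) / s + 1)),
      ∀ i, (r (c i) : ℕ) ≤ i ∧ (i : ℕ) ≤ r (c i) + s := by
  -- The `min` never takes effect, since q ≤ (n - 1) / s; it only makes membership in `Fin n`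
  -- immediate.
  refine ⟨fun q => ⟨min (q * s) (n - 1), by omega⟩,
    fun i => ⟨i / s, Nat.lt_succ_of_le (Nat.div_le_div_right (by omega))⟩, fun i => ?_⟩
  have h1 := Nat.div_add_mod' i s
  have h2 := Nat.mod_lt i hs
  simp only
  omega

/-- With q = ⌊(n - 1)/s⌋, qR ≤ n and n² = R³ give q² ≤ R, hence (q + 1)² ≤ 2q² + 2 ≤ 4R. -/
theorem sq_centres_le {n s : ℕ} {R : ℝ} (hR : 1 ≤ R) (hR3 : R ^ 3 = (n : ℝ) ^ 2) (hs : R ≤ s) :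
    (((n - 1) / s + 1 : ℕ) : ℝ) ^ 2 ≤ 4 * R := by
  have hq : ((((n - 1) / s : ℕ) : ℝ)) * s ≤ n := by
    exact_mod_cast (Nat.div_mul_le_self (n - 1) s).trans (Nat.sub_le n 1)
  set q : ℝ := (((n - 1) / s : ℕ) : ℝ)
  have hq0 : 0 ≤ q := Nat.cast_nonneg _
  have h1 : q * R ≤ n := (mul_le_mul_of_nonneg_left hs hq0).trans hq
  have h2 : q ^ 2 * R ^ 2 ≤ R * R ^ 2 := by
    calc q ^ 2 * R ^ 2 = (q * R) ^ 2 := by ring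
      _ ≤ (n : ℝ) ^ 2 := by gcongr
      _ = R * R ^ 2 := by rw [← hR3]; ring
  have h3 : q ^ 2 ≤ R := le_of_mul_le_mul_right h2 (by positivity)
  push_cast
  nlinarith [sq_nonneg (q - 1)]

end GridCentres

/-! ### Failure probability of the union bound. -/

section Parameters

theorem exp_neg_sq_bound {V K γ : ℝ} (hV : 4 ≤ V) (hK : K ≤ V ^ 2) (hγ : 0 < γ)
    (hγ1 : γ < 1) {t v σ : ℝ} (hσ : 0 < σ) (hv : v = σ ^ 2) (ht : t = 3 * Real.log (V / γ) * σ) :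
    K * (2 * Real.exp (-t ^ 2 / (2 * v))) ≤ γ := by
  have hV0 : 0 < V := by linarith
  -- Since V ≥ 4 > e. With L = log(V/γ) ≥ 1, the exponent (9/2)L² dominates 3L, which leaves
  -- 2V²(γ/V)³ ≤ γ.
  have hL : 1 ≤ Real.log (V / γ) := by
    rw [Real.le_log_iff_exp_le (by positivity)]
    have h1 : V ≤ V / γ := le_div_self hV0.le hγ hγ1.le
    have := Real.exp_one_lt_d9
    linarith
  have hexp : Real.exp (-t ^ 2 / (2 * v)) ≤ (γ / V) ^ 3 := by
    have h1 : -t ^ 2 / (2 * v) = -(9 / 2 * Real.log (V / γ) ^ 2) := by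
      rw [hv, ht]
      field_simp
      norm_num
    have h2 : (γ / V) ^ 3 = Real.exp (-(3 * Real.log (V / γ))) := by
      rw [Real.exp_neg, mul_comm, Real.exp_mul, Real.exp_log (by positivity)]
      norm_cast
      rw [← inv_pow, inv_div]
    rw [h1, h2, Real.exp_le_exp]
    nlinarith
  calc K * (2 * Real.exp (-t ^ 2 / (2 * v))) ≤ V ^ 2 * (2 * (γ / V) ^ 3) := by gcongr
    _ = γ * (2 * γ ^ 2 / V) := by field_simp
    _ ≤ γ * 1 := by
        refine mul_le_mul_of_nonneg_left ?_ hγ.le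
        rw [div_le_one hV0]
        nlinarith
    _ = γ := mul_one γ

end Parameters

end PrivateDistances

/-! ### Choice of parameters and conclusion. -/

open PrivateDistances in
theorem mainTheorem8 (δ₀ : ℝ) (hδ₀ : δ₀ < 1) :
    ∃ C : ℝ, 0 < C ∧
      ∀ n V : ℕ, 1 ≤ n → V = n * n →
      ∀ ε γ δ : ℝ, 0 < ε → ε < 1 → 0 < γ → γ < 1 → 0 < δ → δ ≤ δ₀ →
        ∃ A : Mechanism (grid n) (Fin n × Fin n → Fin n × Fin n → ℝ),
          IsDifferentiallyPrivate A ε δ ∧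
          ∀ Λ : ℝ, 0 ≤ Λ → ∀ w : WeightFunction (grid n), (∀ e, (w e : ℝ) ≤ Λ) →
            1 - γ ≤ (A w : MeasureTheory.Measure _).real
              (accurate w ((V : ℝ) ^ (1 / 3 : ℝ) *
                (C * (Λ + ε⁻¹ * Real.log (V / γ) * Real.sqrt (Real.log (1 / δ)))))) := by
  rcases le_or_gt δ₀ 0 with hneg | hpos
  · exact ⟨1, one_pos, fun n V _ _ ε γ δ _ _ _ _ hδ hδ' => absurd (hδ.trans_le hδ') hneg.not_gt⟩
  -- Privacy asks for κε ≤ log(1/δ) and 8κ ≤ 1. The first follows from κ ≤ log(1/δ₀), the only place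
  -- where C depends on δ₀.
  obtain ⟨κ, hκ, hκ8, hκ0⟩ : ∃ κ : ℝ, 0 < κ ∧ κ ≤ 1 / 8 ∧ κ ≤ Real.log (1 / δ₀) :=
    ⟨min (1 / 8) (Real.log (1 / δ₀)),
      lt_min (by norm_num) (Real.log_pos (by rw [lt_div_iff₀ hpos]; linarith)),
      min_le_left _ _, min_le_right _ _⟩
  -- 8 bounds the cost 2 · 2s of moving both endpoints, as s ≤ 2R; 12 = 3 · 4 joins the noise
  -- threshold 3Lσ, where L = log(V/γ), with m² ≤ 4R.
  refine ⟨8 + 12 / √κ, by positivity, ?_⟩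
  rintro n V hn rfl ε γ δ hε hε1 hγ hγ1 hδ hδ'
  -- For V = 1 the logarithm log(V/γ) can be arbitrarily small, so the tail bound is unavailable;
  -- the constant output 0 is exact.
  rcases hn.eq_or_lt with rfl | hn2
  · refine ⟨fun _ => ⟨Measure.dirac 0, inferInstance⟩, isDifferentiallyPrivate_const _ hε.le hδ.le,
      fun Λ hΛ w _ => ?_⟩
    have hB : 0 ≤ Real.log (((1 * 1 : ℕ) : ℝ) / γ) :=
      Real.log_nonneg (by rw [le_div_iff₀ hγ]; push_cast; linarith)
    have hacc : (0 : Fin 1 × Fin 1 → Fin 1 × Fin 1 → ℝ) ∈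
        accurate w (((1 * 1 : ℕ) : ℝ) ^ (1 / 3 : ℝ) * ((8 + 12 / √κ) * (Λ +
          ε⁻¹ * Real.log (((1 * 1 : ℕ) : ℝ) / γ) * √(Real.log (1 / δ))))) := fun x y => by
      rw [Subsingleton.elim y x, weightedDist_self]
      simp only [Pi.zero_apply, sub_zero, abs_zero]
      positivity
    change 1 - γ ≤ (Measure.dirac _).real _
    rw [measureReal_def, Measure.dirac_apply_of_mem hacc]
    simpa using hγ.le
  set ℓ := Real.log (1 / δ) with hℓ
  have hκℓ : κ ≤ ℓ := hκ0.trans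
    (Real.log_le_log (by positivity) (one_div_le_one_div_of_le hδ hδ'))
  have hℓ0 : 0 < ℓ := hκ.trans_le hκℓ
  have hexpℓ : Real.exp (-ℓ) = δ := by
    rw [hℓ, one_div, Real.log_inv, neg_neg, Real.exp_log hδ]
  have hn0 : (1 : ℝ) ≤ n := by exact_mod_cast hn
  obtain ⟨R, hR⟩ : ∃ R : ℝ, R = ((n * n : ℕ) : ℝ) ^ (1 / 3 : ℝ) := ⟨_, rfl⟩
  have hR1 : 1 ≤ R := by
    rw [hR]
    exact Real.one_le_rpow (by push_cast; nlinarith) (by norm_num)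
  have hR3 : R ^ 3 = (n : ℝ) ^ 2 := by
    rw [hR, ← Real.rpow_natCast, ← Real.rpow_mul (Nat.cast_nonneg _)]
    norm_num
    ring
  rw [← hR]
  have hG := grid_connected hn
  have hRs : R ≤ ⌈R⌉₊ := Nat.le_ceil R
  have hsR : (⌈R⌉₊ : ℝ) ≤ 2 * R := by
    have := Nat.ceil_lt_add_one (zero_le_one.trans hR1)
    linarith
  have hs1 : 1 ≤ ⌈R⌉₊ := by exact_mod_cast hR1.trans hRs
  generalize ⌈R⌉₊ = s at hRs hsR hs1
  have hmR := sq_centres_le hR1 hR3 hRs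
  have hmn : (n - 1) / s + 1 ≤ n := by
    have := Nat.div_le_self (n - 1) s
    omega
  obtain ⟨r, c, hrc⟩ := exists_centres hn hs1
  have hm1 : 1 ≤ (n - 1) / s + 1 := Nat.le_add_left 1 _
  generalize (n - 1) / s + 1 = m at r c hrc hmR hmn hm1
  have hm0 : (1 : ℝ) ≤ m := by exact_mod_cast hm1
  -- m² is the square root of the number m⁴ of pairs of centres, which bounds the ℓ² sensitivity.
  obtain ⟨σ, hσ⟩ : ∃ σ : ℝ, σ = m ^ 2 * (√ℓ / (√κ * ε)) := ⟨_, rfl⟩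
  have hσ0 : 0 < σ := by rw [hσ]; positivity
  obtain ⟨v, hv⟩ : ∃ v : ℝ≥0, (v : ℝ) = σ ^ 2 := ⟨⟨σ ^ 2, sq_nonneg σ⟩, rfl⟩
  have hv0 : v ≠ 0 := by
    have : (0 : ℝ) < v := by rw [hv]; positivity
    exact_mod_cast this.ne'
  have hσ2 : σ ^ 2 = m ^ 4 * ℓ / (κ * ε ^ 2) := by
    rw [hσ, mul_pow, div_pow, mul_pow, Real.sq_sqrt hℓ0.le, Real.sq_sqrt hκ.le]
    ring
  have hcard : (Fintype.card ((Fin m × Fin m) × (Fin m × Fin m)) : ℝ) = (m : ℝ) ^ 4 := by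
    simp only [Fintype.card_prod, Fintype.card_fin]
    push_cast
    ring
  let r' : Fin m × Fin m → Fin n × Fin n := fun q => (r q.1, r q.2)
  let c' : Fin n × Fin n → Fin m × Fin m := fun x => (c x.1, c x.2)
  refine ⟨centreMechanism (grid n) r' c' v,
    isDifferentiallyPrivate_centreMechanism hG r' c' hv0 hε.le ?_ ?_, ?_⟩
  · rw [hcard, hv, hσ2, div_mul_eq_mul_div, le_div_iff₀ (by positivity)]
    have : κ * ε ≤ ℓ := by nlinarith
    calc (m : ℝ) ^ 4 * (κ * ε ^ 2) = m ^ 4 * (κ * ε) * ε := by ring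
      _ ≤ m ^ 4 * ℓ * ε := by gcongr
  · rw [hcard, hv, hσ2, ← hexpℓ, Real.exp_le_exp, neg_le_neg_iff]
    have : (m : ℝ) ^ 4 * ℓ / (κ * ε ^ 2) * ε ^ 2 / (8 * m ^ 4) = ℓ / (8 * κ) := by field_simp
    rw [this, le_div_iff₀ (by positivity)]
    nlinarith
  · intro Λ hΛ w hw
    have hρ : ∀ x, weightedDist w x (r' (c' x)) ≤ 2 * s * Λ := fun x =>
      weightedDist_grid_le w hΛ hw (hrc x.1).1 (hrc x.1).2 (hrc x.2).1 (hrc x.2).2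
    have hn2' : (2 : ℝ) ≤ n := by exact_mod_cast hn2
    have hV4 : (4 : ℝ) ≤ ((n * n : ℕ) : ℝ) := by push_cast; nlinarith
    have hL0 : 0 ≤ Real.log (((n * n : ℕ) : ℝ) / γ) :=
      Real.log_nonneg (by rw [le_div_iff₀ hγ]; linarith)
    refine le_centreMechanism_real_accurate hG v hρ (mul_nonneg (mul_nonneg zero_le_three hL0)
      hσ0.le) (exp_neg_sq_bound hV4 ?_ hγ hγ1 hσ0 hv rfl) ?_
    · rw [hcard]
      have : (m : ℝ) ≤ n := by exact_mod_cast hmn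
      calc (m : ℝ) ^ 4 ≤ (n : ℝ) ^ 4 := by gcongr
        _ = ((n * n : ℕ) : ℝ) ^ 2 := by push_cast; ring
    · set L := Real.log (((n * n : ℕ) : ℝ) / γ)
      have h1 : 2 * (2 * s * Λ) ≤ R * (8 * Λ) := by nlinarith
      have h2 : 3 * L * σ ≤ R * (12 / √κ * (ε⁻¹ * L * √ℓ)) := by
        calc 3 * L * σ = m ^ 2 * (3 * L * (√ℓ / (√κ * ε))) := by rw [hσ]; ring
          _ ≤ 4 * R * (3 * L * (√ℓ / (√κ * ε))) := by gcongr
          _ = _ := by field_simp; ring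
      have h3 : 0 ≤ R * (12 / √κ * Λ) := by positivity
      have h4 : 0 ≤ R * (8 * (ε⁻¹ * L * √ℓ)) := by positivity
      linarith
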